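/- Theorem 1.1. Let $k$ be a commutative Noetherian ring. A tree is a finite, nonempty, connected, acyclic graph. A contraction $\varphi : T \to T'$ of trees is a map on vertices which takes adjacent vertices to vertices that are equal or adjacent, and such that the preimage of each vertex of $T'$ is the vertex set of a (nonempty, connected) subtree of $T$. Let $\mathcal{T}$ be the category of trees with contractions as morphisms. Let $\mathcal{RT}$ be the category of rooted trees (trees with a chosen vertex) with contractions that take the root to the root. For an integer $l \ge 2$, let $\mathcal{T}_l \subset \mathcal{T}$ be the full subcategory of trees with at most $l$ leaves (vertices with exactly one neighbour). For an essentially small category $\mathcal{C}$, let $\operatorname{Rep}_k(\mathcal{C})$ be the category of covariant functors from $\mathcal{C}$ to $k$-modules. For an object $x$ of $\mathcal{C}$, let $P_x \in \operatorname{Rep}_k(\mathcal{C})$ be the functor for which $P_x(y)$ is the free $k$-module with basis $\operatorname{Hom}_{\mathcal{C}}(x,y)$, with morphisms acting by composition. An object $M$ of $\operatorname{Rep}_k(\mathcal{C})$ is finitely generated if it admits a surjection from a direct sum of finitely many $P_x$'s, and $\operatorname{Rep}_k(\mathcal{C})$ is locally Noetherian if every submodule (subobject) of a finitely generated object is finitely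 generated. Then $\operatorname{Rep}_k(\mathcal{T}^{\mathrm{op}})$, $\operatorname{Rep}_k(\mathcal{RT}^{\mathrm{op}})$, and, for every integer $l \ge 2$, $\operatorname{Rep}_k(\mathcal{T}_l^{\mathrm{op}})$ are all locally Noetherian. -/

import Mathlib

open CategoryTheory CategoryTheory.Limits Opposite

universe u v w

/-! ### Modules over a category -/

section Rep

variable (k : Type u) [CommRing k] (C : Type w) [Category.{v} C]

/-- The category of `C`-modules over `k`: covariant functors from `C` to `k`-modules. -/
abbrev RepCat : Type _ := C ⥤ ModuleCat.{max u v} k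

variable {C}

/-- The principal projective `C`-module `P_x`: its value at `y` is the free `k`-module with basis
`Hom (x, y)`, and morphisms act by composition. -/
noncomputable def principalProjective (x : C) : RepCat k C where
  obj y := ModuleCat.of k ((x ⟶ y) →₀ k)
  map {_ _} g := ModuleCat.ofHom (Finsupp.lmapDomain k k (fun f => f ≫ g))
  map_id y := by
    ext : 1
    refine Finsupp.lhom_ext fun f c => ?_
    simp
  map_comp {_ _ _} g h := by
    ext : 1
    refine Finsupp.lhom_ext fun f c => ?_
    simp

variable {k}

/-- A `C`-module is finitely generated if it admits a surjection from a direct sum of finitely many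
principal projectives. -/
def RepCat.IsFinitelyGenerated (M : RepCat k C) : Prop :=
  ∃ (n : ℕ) (x : Fin n → C) (p : (∐ fun i => principalProjective k (x i)) ⟶ M), Epi p

variable (k C)

/-- `Rep_k(C)` is locally Noetherian: every submodule of a finitely generated `C`-module is finitely
generated. -/
def RepLocallyNoetherian : Prop :=
  ∀ (M N : RepCat k C) (i : N ⟶ M), Mono i → M.IsFinitelyGenerated → N.IsFinitelyGenerated

end Rep

/-! ### Trees and contractions -/

/-- A (finite) tree.  Since the category of finite trees is essentially small, it is enough to
take vertex sets in `Type`. -/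
structure FinTree where
  /-- the vertices -/
  V : Type
  [finite : Finite V]
  /-- the underlying graph -/
  graph : SimpleGraph V
  isTree : graph.IsTree

attribute [instance] FinTree.finite

namespace FinTree

/-- A contraction of trees, given by its map on vertices: a simplicial map (each edge goes to an
edge or to a vertex) such that the preimage of every vertex is the vertex set of a subtree (that is,
it is nonempty and connected).  For trees this forces the map to be surjective with connected fibres
also over the edges, and it is automatically a homotopy equivalence. -/
@[ext]
structure Contraction (S T : FinTree) where
  /-- the map on vertices -/
  toFun : S.V → T.V
  map_adj : ∀ a b, S.graph.Adj a b → toFun a = toFun b ∨ T.graph.Adj (toFun a) (toFun b)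
  connected_fiber : ∀ t : T.V, (S.graph.induce {s | toFun s = t}).Connected

namespace Contraction

variable {R S T : FinTree}

/-- The identity contraction. -/
def id (S : FinTree) : Contraction S S where
  toFun := fun s => s
  map_adj := fun _ _ h => Or.inr h
  connected_fiber := fun t => by
    have : Subsingleton {s : S.V | s = t} := ⟨fun a b => Subtype.ext (a.2.trans b.2.symm)⟩
    have : Nonempty {s : S.V | s = t} := ⟨⟨t, rfl⟩⟩
    exact SimpleGraph.IsTree.of_subsingleton.connected

theorem exists_adj (f : Contraction S T) {a b : T.V} (hab : T.graph.Adj a b) :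
    ∃ x y, S.graph.Adj x y ∧ f.toFun x = a ∧ f.toFun y = b := by
  by_contra hcon
  push Not at hcon
  obtain ⟨⟨x, hx⟩⟩ := (f.connected_fiber a).nonempty
  obtain ⟨⟨y, hy⟩⟩ := (f.connected_fiber b).nonempty
  simp only [Set.mem_ofPred_eq] at hx hy
  have hb := (SimpleGraph.isAcyclic_iff_forall_adj_isBridge.1 T.isTree.isAcyclic) hab
  rw [SimpleGraph.isBridge_iff] at hb
  apply hb
  have key : ∀ u v, S.graph.Reachable u v →
      (T.graph \ SimpleGraph.fromEdgeSet {s(a, b)}).Reachable (f.toFun u) (f.toFun v) := by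
    rintro u v ⟨p⟩
    induction p with
    | nil => rfl
    | @cons u w v h p ih =>
      refine SimpleGraph.Reachable.trans ?_ ih
      rcases f.map_adj _ _ h with h1 | h1
      · rw [h1]
      · refine SimpleGraph.Adj.reachable ?_
        rw [SimpleGraph.sdiff_adj]
        refine ⟨h1, ?_⟩
        rw [SimpleGraph.fromEdgeSet_adj]
        rintro ⟨h2, -⟩
        rw [Set.mem_singleton_iff, Sym2.eq_iff] at h2
        rcases h2 with ⟨e1, e2⟩ | ⟨e1, e2⟩
        · exact hcon u w h e1 e2
        · exact hcon w u h.symm e2 e1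
  have := key x y (S.isTree.connected.preconnected x y)
  rwa [hx, hy] at this

/-- The preimage of a connected set under a contraction is connected. -/
theorem connected_preimage (f : Contraction S T) (A : Set T.V)
    (hA : (T.graph.induce A).Connected) : (S.graph.induce {s | f.toFun s ∈ A}).Connected := by
  have fib : ∀ (x y : S.V) (hx : f.toFun x ∈ A) (hy : f.toFun y ∈ A), f.toFun x = f.toFun y →
      (S.graph.induce {s | f.toFun s ∈ A}).Reachable ⟨x, hx⟩ ⟨y, hy⟩ := by
    intro x y hx hy hxy
    have h := (f.connected_fiber (f.toFun y)).preconnected ⟨x, hxy⟩ ⟨y, rfl⟩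
    have hsub : {s | f.toFun s = f.toFun y} ⊆ {s | f.toFun s ∈ A} := by
      intro s hs
      simp only [Set.mem_ofPred_eq] at hs ⊢
      rwa [hs]
    exact h.map (SimpleGraph.induceHomOfLE S.graph hsub).toHom
  have key : ∀ (a b : A), (T.graph.induce A).Reachable a b → ∀ (x y : S.V)
      (hx : f.toFun x = a) (hy : f.toFun y = b),
      (S.graph.induce {s | f.toFun s ∈ A}).Reachable
        ⟨x, show f.toFun x ∈ A from hx ▸ a.2⟩ ⟨y, show f.toFun y ∈ A from hy ▸ b.2⟩ := by
    rintro a b ⟨p⟩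
    induction p with
    | nil => intro x y hx hy; exact fib _ _ _ _ (hx.trans hy.symm)
    | @cons a c b h p ih =>
      intro x y hx hy
      obtain ⟨x', y', hadj, hx', hy'⟩ := f.exists_adj (SimpleGraph.comap_adj.1 h)
      have hx'A : f.toFun x' ∈ A := by rw [hx']; exact a.2
      have hy'A : f.toFun y' ∈ A := by rw [hy']; exact c.2
      refine (fib x x' _ hx'A (hx.trans hx'.symm)).trans (SimpleGraph.Reachable.trans ?_
        (ih y' y hy' hy))
      exact SimpleGraph.Adj.reachable (SimpleGraph.comap_adj.2 hadj)
  obtain ⟨⟨a, ha⟩⟩ := hA.nonempty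
  obtain ⟨⟨x, hx⟩⟩ := (f.connected_fiber a).nonempty
  have : Nonempty {s | f.toFun s ∈ A} := ⟨⟨x, by
    simp only [Set.mem_ofPred_eq] at hx ⊢
    rwa [hx]⟩⟩
  exact ⟨fun x y => key ⟨_, x.2⟩ ⟨_, y.2⟩ (hA.preconnected _ _) x y rfl rfl⟩

/-- Composition of contractions: `f` followed by `g`. -/
def comp (f : Contraction R S) (g : Contraction S T) : Contraction R T where
  toFun := fun r => g.toFun (f.toFun r)
  map_adj := fun a b h => by
    rcases f.map_adj a b h with h1 | h1
    · exact Or.inl (by rw [h1])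
    · exact g.map_adj _ _ h1
  connected_fiber := fun t => f.connected_preimage {s | g.toFun s = t} (g.connected_fiber t)

end Contraction

/-- The category of trees, with contractions as morphisms. -/
instance : Category FinTree where
  Hom := Contraction
  id := Contraction.id
  comp := Contraction.comp

/-- The leaves of a tree: the vertices with exactly one neighbour. -/
def leaves (T : FinTree) : Set T.V := {a | ∃! b, T.graph.Adj a b}

/-- The full subcategory of trees with at most `l` leaves. -/
abbrev AtMostLeaves (l : ℕ) : Type _ :=
  ObjectProperty.FullSubcategory (fun T : FinTree => T.leaves.ncard ≤ l)

end FinTree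

/-- A rooted tree: a tree together with a choice of vertex. -/
structure RootedFinTree where
  /-- the underlying tree -/
  tree : FinTree
  /-- the root -/
  root : tree.V

namespace RootedFinTree

/-- A contraction of rooted trees: a contraction that takes the root to the root. -/
@[ext]
structure Contraction (S T : RootedFinTree) where
  /-- the underlying contraction of trees -/
  toContraction : FinTree.Contraction S.tree T.tree
  map_root : toContraction.toFun S.root = T.root

/-- The category of rooted trees, with root-preserving contractions as morphisms. -/
instance : Category RootedFinTree where
  Hom := Contraction
  id S := ⟨FinTree.Contraction.id S.tree, rfl⟩
  comp f g := ⟨f.toContraction.comp g.toContraction, by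
    change g.toContraction.toFun (f.toContraction.toFun _) = _
    rw [f.map_root, g.map_root]⟩

end RootedFinTree

/-!
The proof is by Gröbner bases for representations of categories of trees. The value at `T` of a
direct sum of principal projectives has a basis of "monomials": contractions from `T` to one of
finitely many fixed trees. Leading terms and Hilbert's basis argument work as for polynomial rings
(`exists_finite_le_generatedBy`), provided that monomials can be compared in a way that is
compatible with morphisms and that divisibility of monomials is a well-quasi-order.

Since trees have automorphisms, no choice of monomial orders is compatible with all contractions.
So each tree is considered with all its rootings and depth-first numberings of the vertices
(`FinTree.DFSOrder`), and a comparison of monomials for each of these; divisibility is required to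
respect the numberings. For a rooted tree `T`, a contraction `f : T → S` is the right adjoint, for
the ancestor relations, of the section `S → T` that takes a vertex to the top of its fibre
(`FinTree.DFSOrder.sec_anc_iff`). Monomials are compared through the values of these sections,
lexicographically. Conversely each embedding of ordered trees has a right adjoint, which is a
contraction (`FinTree.DFSOrder.IsEmbedding.exists_contraction`). Divisibility of monomials hence
becomes embeddability of planar trees whose vertices carry finitely many labels, namely the
vertices of `S` over which the section passes through the given vertex. This is a well-quasi-order
by Kruskal's theorem (`LabelledForest.wellQuasiOrdered_embeds`).

All this takes place over a fixed target tree and never leaves a given class of trees, so that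
rooted trees and full subcategories are covered by the same argument
(`repLocallyNoetherian_op_of_faithful`).
-/

/-! ### Finite generation in terms of elements -/

section Elements

variable {k : Type u} [CommRing k] {C : Type w} [Category.{v} C]

/-- The morphism from a principal projective given by the Yoneda lemma. -/
noncomputable def principalProjectiveDesc (M : RepCat k C) {x : C} (m : M.obj x) :
    principalProjective k x ⟶ M where
  app y := ModuleCat.ofHom (Finsupp.linearCombination k fun f : x ⟶ y => M.map f m)
  naturality y z g := by
    ext : 1
    refine Finsupp.lhom_ext fun f c => ?_
    simp [principalProjective]

theorem RepCat.IsFinitelyGenerated.exists_span {M : RepCat k C} (hM : M.IsFinitelyGenerated) :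
    ∃ (n : ℕ) (x : Fin n → C) (m : ∀ i, M.obj (x i)), ∀ y,
      Submodule.span k (Set.range fun e : Σ i, x i ⟶ y => M.map e.2 (m e.1)) = ⊤ := by
  obtain ⟨n, x, p, hp⟩ := hM
  let m : ∀ i, M.obj (x i) := fun i =>
    (Sigma.ι (fun i => principalProjective k (x i)) i ≫ p).app (x i)
      (Finsupp.single (𝟙 (x i)) (1 : k))
  refine ⟨n, x, m, fun y => ?_⟩
  set S := Submodule.span k (Set.range fun e : Σ i, x i ⟶ y => M.map e.2 (m e.1)) with hS
  have hpy : Epi (p.app y) := (NatTrans.epi_iff_epi_app p).1 hp y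
  let q : M.obj y ⟶ ModuleCat.of k (M.obj y ⧸ S) := ModuleCat.ofHom S.mkQ
  have hq : p.app y ≫ q = 0 := by
    refine (isColimitOfPreserves ((evaluation C (ModuleCat.{max u v} k)).obj y)
      (coproductIsCoproduct fun i => principalProjective k (x i))).hom_ext ?_
    rintro ⟨i⟩
    ext : 1
    refine Finsupp.lhom_ext fun f c => ?_
    set φ := Sigma.ι (fun i => principalProjective k (x i)) i ≫ p with hφ
    have h1 : (φ.app y).hom (Finsupp.single f c) = c • M.map f (m i) := by
      have h2 : (φ.app y).hom ((principalProjective k (x i)).map f (Finsupp.single (𝟙 (x i)) 1)) =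
          M.map f (m i) :=
        ConcreteCategory.congr_hom (φ.naturality f) (Finsupp.single (𝟙 (x i)) (1 : k))
      have h3 : (principalProjective k (x i)).map f (Finsupp.single (𝟙 (x i)) (1 : k)) =
          (Finsupp.single f (1 : k) : (x i ⟶ y) →₀ k) := by
        refine (Finsupp.mapDomain_single (f := fun g => g ≫ f)).trans ?_
        rw [Category.id_comp]
      rw [← h2, h3]
      exact (congrArg _ (Finsupp.smul_single_one f c).symm).trans (map_smul (φ.app y).hom c _)
    refine Eq.trans (b := S.mkQ ((φ.app y).hom (Finsupp.single f c))) rfl ?_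
    rw [h1]
    exact (Submodule.Quotient.mk_eq_zero S).2
      (S.smul_mem c (Submodule.subset_span ⟨⟨i, f⟩, rfl⟩))
  have hq0 : q = 0 := by
    rw [← cancel_epi (p.app y), hq, comp_zero]
  have : S.mkQ = 0 := by
    have := congrArg ModuleCat.Hom.hom hq0
    exact this
  rw [← Submodule.ker_mkQ S, this, LinearMap.ker_zero]

theorem RepCat.isFinitelyGenerated_of_span {M : RepCat k C} {n : ℕ} (x : Fin n → C)
    (m : ∀ i, M.obj (x i))
    (h : ∀ y, Submodule.span k (Set.range fun e : Σ i, x i ⟶ y => M.map e.2 (m e.1)) = ⊤) :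
    M.IsFinitelyGenerated := by
  refine ⟨n, x, Sigma.desc fun i => principalProjectiveDesc M (m i), ?_⟩
  rw [NatTrans.epi_iff_epi_app]
  intro y
  rw [ModuleCat.epi_iff_surjective]
  intro z
  have hz : z ∈ LinearMap.range ((Sigma.desc fun i => principalProjectiveDesc M (m i)).app y).hom := by
    have : z ∈ (⊤ : Submodule k (M.obj y)) := trivial
    rw [← h y] at this
    refine Submodule.span_le.2 ?_ this
    rintro _ ⟨⟨i, f⟩, rfl⟩
    refine ⟨(Sigma.ι (fun i => principalProjective k (x i)) i).app y (Finsupp.single f (1 : k)), ?_⟩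
    have h1 := congrArg (fun t => t.app y)
      (Sigma.ι_desc (fun i => principalProjectiveDesc M (m i)) i)
    have h2 := ConcreteCategory.congr_hom h1 (Finsupp.single f (1 : k))
    refine h2.trans ?_
    exact (Finsupp.linearCombination_single k (1 : k) f).trans (one_smul _ _)
  exact hz

end Elements

/-! ### Noetherianity from well-quasi-orders on morphisms -/

section Criterion

variable {k : Type u} [CommRing k] {C : Type w} [Category.{v} C] {n : ℕ} (x : Fin n → C)

/-- The monomials at `y`: they form a basis of the value at `y` of `⨁ i, P_{x i}`. -/
abbrev Monomial (y : C) : Type v := Σ i, x i ⟶ y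

variable {x}

/-- The action of morphisms on monomials. -/
def Monomial.push {y z : C} (g : y ⟶ z) (e : Monomial x y) : Monomial x z := ⟨e.1, e.2 ≫ g⟩

theorem Monomial.push_push {y z t : C} (g : y ⟶ z) (h : z ⟶ t) (e : Monomial x y) :
    (e.push g).push h = e.push (g ≫ h) := by
  simp [Monomial.push]

/-- The value at `z` of the submodule of `⨁ i, P_{x i}` generated by a set `S` of elements, each of
which is given with the object at which it lives. -/
noncomputable def generatedBy (S : Set (Σ y : C, Monomial x y →₀ k)) (z : C) :
    Submodule k (Monomial x z →₀ k) :=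
  Submodule.span k {v | ∃ c ∈ S, ∃ g : c.1 ⟶ z, v = c.2.mapDomain (Monomial.push g)}

/-- `e` is the leading monomial of `v`, for monomials compared by means of `key`. -/
def IsLeading {E K : Type*} [LinearOrder K] (key : E → K) (v : E →₀ k) (e : E) : Prop :=
  v e ≠ 0 ∧ ∀ e', v e' ≠ 0 → key e' ≤ key e

theorem exists_isLeading {E K : Type*} [LinearOrder K] (key : E → K) {v : E →₀ k} (hv : v ≠ 0) :
    ∃ e, IsLeading key v e := by
  obtain ⟨e, he, h⟩ := Finset.exists_max_image v.support key (Finsupp.support_nonempty_iff.2 hv)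
  exact ⟨e, Finsupp.mem_support_iff.1 he, fun e' he' => h e' (Finsupp.mem_support_iff.2 he')⟩

variable {K : Type*} {O : C → Type*} (key : ∀ {x y : C}, O y → (x ⟶ y) → K)

/-- The comparison key of a monomial, for a given order datum at `y`. -/
def monomialKey {y : C} (o : O y) (e : Monomial x y) : Fin n ×ₗ K := toLex (e.1, key o e.2)

variable {key} in
theorem monomialKey_injective
    (hinj : ∀ {x y : C} (o : O y), Function.Injective (key o : (x ⟶ y) → K)) {y : C} (o : O y) :
    Function.Injective (monomialKey key o : Monomial x y → Fin n ×ₗ K) := by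
  rintro ⟨i, a⟩ ⟨j, b⟩ h
  simp only [monomialKey, EmbeddingLike.apply_eq_iff_eq, Prod.mk.injEq] at h
  obtain ⟨rfl, h⟩ := h
  rw [hinj o h]

variable [LinearOrder K]

/-- Composition with `g` is strictly monotone on morphisms. -/
def StrictMonoOnHoms {y z : C} (o : O y) (g : y ⟶ z) (o' : O z) : Prop :=
  ∀ (t : C) (a b : t ⟶ y), key o a < key o b → key o' (a ≫ g) < key o' (b ≫ g)

variable {key}

theorem StrictMonoOnHoms.comp {y z t : C} {o : O y} {o' : O z} {o'' : O t} {g : y ⟶ z} {h : z ⟶ t}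
    (hg : StrictMonoOnHoms key o g o') (hh : StrictMonoOnHoms key o' h o'') :
    StrictMonoOnHoms key o (g ≫ h) o'' := fun s a b hab => by
  simpa using hh s _ _ (hg s a b hab)

theorem StrictMonoOnHoms.monomialKey_lt {y z : C} {o : O y} {o' : O z} {g : y ⟶ z}
    (hg : StrictMonoOnHoms key o g o') {e e' : Monomial x y}
    (h : monomialKey key o e < monomialKey key o e') :
    monomialKey key o' (e.push g) < monomialKey key o' (e'.push g) := by
  obtain ⟨i, a⟩ := e
  obtain ⟨j, b⟩ := e'
  simp only [monomialKey, Monomial.push, Prod.Lex.toLex_lt_toLex] at h ⊢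
  rcases h with h | ⟨rfl, h⟩
  · exact Or.inl h
  · exact Or.inr ⟨rfl, hg _ _ _ h⟩

theorem StrictMonoOnHoms.push_injective
    (hinj : ∀ {x y : C} (o : O y), Function.Injective (key o : (x ⟶ y) → K))
    {y z : C} {o : O y} {o' : O z} {g : y ⟶ z}
    (hg : StrictMonoOnHoms key o g o') : Function.Injective (Monomial.push (x := x) g) := by
  intro a b hab
  apply monomialKey_injective hinj o
  rcases lt_trichotomy (monomialKey key o a) (monomialKey key o b) with h | h | h
  · exact absurd (hg.monomialKey_lt h) (by rw [hab]; exact lt_irrefl _)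
  · exact h
  · exact absurd (hg.monomialKey_lt h) (by rw [hab]; exact lt_irrefl _)

theorem StrictMonoOnHoms.monomialKey_le {y z : C} {o : O y} {o' : O z} {g : y ⟶ z}
    (hinj : ∀ {x y : C} (o : O y), Function.Injective (key o : (x ⟶ y) → K))
    (hg : StrictMonoOnHoms key o g o') {e e' : Monomial x y}
    (h : monomialKey key o e ≤ monomialKey key o e') :
    monomialKey key o' (e.push g) ≤ monomialKey key o' (e'.push g) := by
  rcases h.lt_or_eq with h | h
  · exact (hg.monomialKey_lt h).le
  · rw [monomialKey_injective hinj o h]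

variable (key) in
/-- Divisibility of monomials, each taken at an object with an order datum: `p` divides `q` if some
morphism that is strictly monotone for the order data takes `p` to `q`. -/
def Divides (p q : Σ y : C, O y × Monomial x y) : Prop :=
  ∃ g : p.1 ⟶ q.1, p.2.2.push g = q.2.2 ∧ StrictMonoOnHoms key p.2.1 g q.2.1

instance : IsPreorder (Σ y : C, O y × Monomial x y) (Divides key) where
  refl p := ⟨𝟙 _, by simp [Monomial.push], fun _ _ _ h => by simpa using h⟩
  trans := by
    rintro ⟨y, o, e⟩ ⟨z, o', e'⟩ ⟨t, o'', e''⟩ ⟨g, h1, h2⟩ ⟨h, h3, h4⟩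
    refine ⟨g ≫ h, ?_, h2.comp h4⟩
    dsimp only at h1 h3 ⊢
    rw [← Monomial.push_push, h1, h3]

theorem wellQuasiOrdered_divides
    (hwqo : ∀ (s : C) (y : ℕ → C) (o : ∀ m, O (y m)) (f : ∀ m, s ⟶ y m), ∃ i j, i < j ∧
      ∃ g : y i ⟶ y j, f i ≫ g = f j ∧ StrictMonoOnHoms key (o i) g (o j)) :
    WellQuasiOrdered (Divides key : (Σ y : C, O y × Monomial x y) → _ → Prop) := by
  intro p
  have hfin : (Set.univ : Set (Fin n)).PartiallyWellOrderedOn (· = ·) :=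
    Set.finite_univ.partiallyWellOrderedOn
  obtain ⟨σ, hσ⟩ := hfin.exists_monotone_subseq (f := fun m => (p m).2.2.1) fun _ => trivial
  have hp : ∀ m, ∃ f : x (p (σ 0)).2.2.1 ⟶ (p (σ m)).1, (p (σ m)).2.2 = ⟨_, f⟩ := fun m => by
    have h := hσ 0 m (Nat.zero_le m)
    generalize (p (σ 0)).2.2.1 = i at h
    subst h
    exact ⟨_, rfl⟩
  choose f hf using hp
  obtain ⟨i, j, hij, g, h1, h2⟩ := hwqo _ (fun m => (p (σ m)).1) (fun m => (p (σ m)).2.1) f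
  refine ⟨σ i, σ j, σ.lt_iff_lt.2 hij, g, ?_, h2⟩
  exact (congrArg (Monomial.push g) (hf i)).trans (.trans (by rw [← h1]; rfl) (hf j).symm)

/-- Submodules of `⨁ i, P_{x i}` are finitely generated. For each order datum, the leading
coefficients of the elements of a submodule form ideals that grow along divisibility of monomials;
were the submodule not finitely generated, then a sequence of generators with leading monomials as
small as possible would contain one whose leading term is a combination of multiples of previous
leading terms, and subtracting these would give a smaller leading monomial. -/
theorem exists_finite_le_generatedBy [IsNoetherianRing k] [∀ x y : C, Finite (x ⟶ y)]
    [∀ y, Nonempty (O y)]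
    (hinj : ∀ {x y : C} (o : O y), Function.Injective (key o : (x ⟶ y) → K))
    (hwqo : ∀ (s : C) (y : ℕ → C) (o : ∀ m, O (y m)) (f : ∀ m, s ⟶ y m), ∃ i j, i < j ∧
      ∃ g : y i ⟶ y j, f i ≫ g = f j ∧ StrictMonoOnHoms key (o i) g (o j))
    (N : ∀ y : C, Submodule k (Monomial x y →₀ k))
    (hN : ∀ (y z : C) (g : y ⟶ z), ∀ v ∈ N y, v.mapDomain (Monomial.push g) ∈ N z) :
    ∃ S : Set (Σ y : C, Monomial x y →₀ k), S.Finite ∧ (∀ c ∈ S, c.2 ∈ N c.1) ∧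
      ∀ y, N y ≤ generatedBy S y := by
  by_contra! hcon
  let Q := Σ y : C, (O y × Monomial x y) × (Monomial x y →₀ k)
  let pr : Q → Σ y : C, Monomial x y →₀ k := fun c => ⟨c.1, c.2.2⟩
  let P : Q → Set Q → Prop := fun c t => (∀ d ∈ t, d.2.2 ∈ N d.1) →
    c.2.2 ∈ N c.1 ∧ c.2.2 ∉ generatedBy (pr '' t) c.1 ∧
    IsLeading (monomialKey key c.2.1.1) c.2.2 c.2.1.2 ∧
    ∀ w ∈ N c.1, w ∉ generatedBy (pr '' t) c.1 → ∀ e, IsLeading (monomialKey key c.2.1.1) w e →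
      monomialKey key c.2.1.1 c.2.1.2 ≤ monomialKey key c.2.1.1 e
  have hP : ∀ t : Set Q, t.Finite → ∃ c, P c t := by
    intro t ht
    by_cases htN : ∀ d ∈ t, d.2.2 ∈ N d.1
    swap
    · obtain ⟨c, -⟩ := not_forall.1 htN
      exact ⟨c, fun h => absurd h htN⟩
    obtain ⟨y, hy⟩ := hcon (pr '' t) (ht.image _) (by rintro _ ⟨d, hd, rfl⟩; exact htN d hd)
    obtain ⟨w, hw, hw'⟩ := Set.not_subset.1 hy
    obtain ⟨o⟩ := (inferInstance : Nonempty (O y))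
    obtain ⟨e, he⟩ := exists_isLeading (monomialKey key o) (v := w)
      (by rintro rfl; exact hw' (Submodule.zero_mem _))
    obtain ⟨e', ⟨v, hv, hv', hve⟩, hmin⟩ := Set.exists_min_image
      {e | ∃ v ∈ N y, v ∉ generatedBy (pr '' t) y ∧ IsLeading (monomialKey key o) v e}
      (monomialKey key o) (Set.toFinite _) ⟨e, w, hw, hw', he⟩
    exact ⟨⟨y, (o, e'), v⟩, fun _ => ⟨hv, hv', hve, fun w hw hw' e he => hmin e ⟨w, hw, hw', he⟩⟩⟩
  obtain ⟨u, hu⟩ := Set.seq_of_forall_finite_exists hP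
  have huN : ∀ m, (u m).2.2 ∈ N (u m).1 := fun m => by
    induction m using Nat.strong_induction_on with
    | _ m ih => exact (hu m (by rintro _ ⟨i, hi, rfl⟩; exact ih i hi)).1
  have hu' := fun m => (hu m (by rintro _ ⟨i, -, rfl⟩; exact huN i)).2
  obtain ⟨σ, hσ⟩ := ((Set.partiallyWellOrderedOn_univ_iff.2
    (wellQuasiOrdered_divides hwqo)).exists_monotone_subseq
    (f := fun m => (⟨(u m).1, (u m).2.1⟩ : Σ y : C, O y × Monomial x y)) fun _ => trivial)
  let c : ℕ → k := fun i => (u (σ i)).2.2 (u (σ i)).2.1.2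
  let I : ℕ →o Ideal k :=
    ⟨fun m => Ideal.span (c '' Set.Iio m), fun a b hab =>
      Ideal.span_mono (Set.image_mono (Set.Iio_subset_Iio hab))⟩
  obtain ⟨m, hm⟩ := monotone_stabilizes_iff_noetherian.2 (inferInstance : IsNoetherian k k) I
  have hcm : c m ∈ Ideal.span (c '' Set.Iio m) := by
    have h : c m ∈ I (m + 1) := Ideal.subset_span ⟨m, Nat.lt_succ_self m, rfl⟩
    rwa [← hm (m + 1) (Nat.le_succ m)] at h
  obtain ⟨hnot, hlead, hmin⟩ := hu' (σ m)
  set G := generatedBy (pr '' (u '' Set.Iio (σ m))) (u (σ m)).1 with hG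
  set κ := monomialKey key (x := x) (u (σ m)).2.1.1 with hκ
  set e := (u (σ m)).2.1.2 with he
  -- A combination of multiples of previous generators has the same leading term.
  obtain ⟨w, hwN, hwG, hwe, hwle⟩ : ∃ w ∈ N (u (σ m)).1, w ∈ G ∧ w e = c m ∧
      ∀ e', w e' ≠ 0 → κ e' ≤ κ e := by
    refine Submodule.span_induction (p := fun a _ => ∃ w ∈ N (u (σ m)).1, w ∈ G ∧ w e = a ∧
      ∀ e', w e' ≠ 0 → κ e' ≤ κ e) ?_ ?_ ?_ ?_ hcm
    · rintro _ ⟨i, hi, rfl⟩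
      obtain ⟨g, hg, hgm⟩ := hσ i m (le_of_lt hi)
      have hinj' := StrictMonoOnHoms.push_injective (x := x) hinj hgm
      have hg' : (u (σ i)).2.1.2.push g = e := hg
      refine ⟨(u (σ i)).2.2.mapDomain (Monomial.push g), hN _ _ _ _ (huN _),
        Submodule.subset_span ⟨_, ⟨_, ⟨σ i, σ.lt_iff_lt.2 hi, rfl⟩, rfl⟩, g, rfl⟩, ?_, ?_⟩
      · rw [← hg', Finsupp.mapDomain_apply hinj']
      · intro e' he'
        by_cases hr : e' ∈ Set.range (Monomial.push (x := x) g)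
        · obtain ⟨e'', rfl⟩ := hr
          rw [Finsupp.mapDomain_apply hinj'] at he'
          rw [← hg']
          exact hgm.monomialKey_le hinj ((hu' (σ i)).2.1.2 e'' he')
        · exact absurd (Finsupp.mapDomain_of_notMem_range _ _ hr) he'
    · exact ⟨0, zero_mem _, zero_mem _, rfl, fun e' h => absurd rfl h⟩
    · rintro a b - - ⟨v, h1, h2, h3, h4⟩ ⟨w, g1, g2, g3, g4⟩
      refine ⟨v + w, add_mem h1 g1, add_mem h2 g2, by simp [h3, g3], fun e' h => ?_⟩
      by_cases hv : v e' = 0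
      · exact g4 e' fun h0 => h (by simp [hv, h0])
      · exact h4 e' hv
    · rintro a b - ⟨v, h1, h2, h3, h4⟩
      refine ⟨a • v, Submodule.smul_mem _ _ h1, Submodule.smul_mem _ _ h2, by simp [h3],
        fun e' h => h4 e' fun h0 => h (by simp [h0])⟩
  have hsub : (u (σ m)).2.2 - w ∉ G := fun h => hnot (by simpa using add_mem h hwG)
  obtain ⟨e', he'⟩ := exists_isLeading κ (v := (u (σ m)).2.2 - w)
    (fun h => hsub (h ▸ zero_mem _))
  have h1 := hmin _ (sub_mem (huN _) hwN) hsub e' he'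
  have h2 : κ e' ≤ κ e := by
    by_cases hv : (u (σ m)).2.2 e' = 0
    · exact hwle e' fun h0 => he'.1 (by simp [hv, h0])
    · exact hlead.2 e' hv
  have h3 : e' = e := monomialKey_injective hinj _ (le_antisymm h2 h1)
  exact he'.1 (by rw [h3, Finsupp.sub_apply, hwe, sub_self])

/-- A criterion in the spirit of Gröbner bases. Each object `y` carries order data `o : O y`, each of
which totally orders all morphisms into `y` by means of `key o`. If all sequences of morphisms out of
a fixed object contain two, of which the first divides the second by a morphism that is strictly
monotone for the order data, then representations are locally Noetherian. -/
theorem repLocallyNoetherian_of_wellQuasiOrdered [IsNoetherianRing k]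
    [∀ x y : C, Finite (x ⟶ y)] [∀ y, Nonempty (O y)]
    (hinj : ∀ {x y : C} (o : O y), Function.Injective (key o : (x ⟶ y) → K))
    (hwqo : ∀ (s : C) (y : ℕ → C) (o : ∀ m, O (y m)) (f : ∀ m, s ⟶ y m), ∃ i j, i < j ∧
      ∃ g : y i ⟶ y j, f i ≫ g = f j ∧ StrictMonoOnHoms key (o i) g (o j)) :
    RepLocallyNoetherian k C := by
  intro M N ι hι hM
  obtain ⟨n, x, m, hspan⟩ := hM.exists_span
  have hιinj : ∀ y, Function.Injective (ι.app y).hom := fun y =>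
    (ModuleCat.mono_iff_injective _).1 ((NatTrans.mono_iff_mono_app ι).1 hι y)
  let F : ∀ y, (Monomial x y →₀ k) →ₗ[k] M.obj y := fun y =>
    Finsupp.linearCombination k fun e => M.map e.2 (m e.1)
  have hFsurj : ∀ y, LinearMap.range (F y) = ⊤ := fun y => by
    rw [Finsupp.range_linearCombination]; exact hspan y
  have hFmap : ∀ {y z : C} (g : y ⟶ z) v,
      F z (v.mapDomain (Monomial.push g)) = (M.map g).hom (F y v) := by
    intro y z g v
    rw [← LinearMap.comp_apply, ← Finsupp.lmapDomain_apply k k, ← LinearMap.comp_apply]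
    congr 1
    refine Finsupp.lhom_ext fun e a => ?_
    simp [F, Monomial.push]
  have hnat : ∀ {y z : C} (g : y ⟶ z) v, (ι.app z).hom (N.map g v) = (M.map g).hom ((ι.app y).hom v) :=
    fun g v => ConcreteCategory.congr_hom (ι.naturality g) v
  obtain ⟨S, hS, hSN, hSgen⟩ := exists_finite_le_generatedBy (x := x) (key := key) hinj hwqo
    (fun y => (LinearMap.range (ι.app y).hom).comap (F y)) (by
      rintro y z g v ⟨t, ht⟩
      exact ⟨N.map g t, by rw [hnat, ht, hFmap]⟩)
  obtain ⟨l, s, -, rfl⟩ := hS.fin_param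
  choose t ht using fun i => hSN (s i) ⟨i, rfl⟩
  refine RepCat.isFinitelyGenerated_of_span (fun i => (s i).1) t fun y => ?_
  rw [eq_top_iff]
  intro a _
  obtain ⟨v, hv⟩ : (ι.app y).hom a ∈ LinearMap.range (F y) := by rw [hFsurj]; trivial
  have hvgen := hSgen y (show v ∈ _ from ⟨a, hv.symm⟩)
  have key : F y v ∈ (Submodule.span k
      (Set.range fun e : Σ i, (s i).1 ⟶ y => N.map e.2 (t e.1))).map (ι.app y).hom := by
    refine Submodule.span_induction (p := fun v _ => F y v ∈ (Submodule.span k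
      (Set.range fun e : Σ i, (s i).1 ⟶ y => N.map e.2 (t e.1))).map (ι.app y).hom)
      ?_ ?_ ?_ ?_ hvgen
    · rintro _ ⟨_, ⟨i, rfl⟩, g, rfl⟩
      exact ⟨N.map g (t i), Submodule.subset_span ⟨⟨i, g⟩, rfl⟩, by rw [hnat, ht, hFmap]⟩
    · rw [map_zero]; exact zero_mem _
    · intro a b _ _ h1 h2; rw [map_add]; exact add_mem h1 h2
    · intro a b _ h1; rw [map_smul]; exact Submodule.smul_mem _ _ h1
  obtain ⟨b, hb, hba⟩ := key
  rwa [← hιinj y (hba.trans hv)]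

end Criterion

/-! ### Minimal bad sequences and Kruskal's theorem for ordered forests -/

/-- The key step of the Nash-Williams argument: the elements that lie strictly below some term of a
minimal bad sequence, and have smaller rank than it, are well-quasi-ordered. -/
theorem partiallyWellOrderedOn_below_minBadSeq {α : Type*} {r : α → α → Prop} [IsTrans α r]
    {rk : α → ℕ} {f : ℕ → α}
    (hbad : Set.PartiallyWellOrderedOn.IsBadSeq r Set.univ f)
    (hmin : ∀ n, Set.PartiallyWellOrderedOn.IsMinBadSeq r rk Set.univ n f) :
    {d | ∃ n, r d (f n) ∧ rk d < rk (f n)}.PartiallyWellOrderedOn r := by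
  rw [Set.partiallyWellOrderedOn_iff_exists_lt]
  intro d hd
  choose κ hκ hrk using hd
  by_contra! hcon
  obtain ⟨m, hm⟩ : ∃ m, ∀ j, κ m ≤ κ j :=
    ⟨Function.argmin κ, fun j => Function.argmin_le κ j⟩
  -- Splicing the sequence `d` into `f` at the first possible place contradicts minimality.
  refine hmin (κ m) (fun n => if n < κ m then f n else d (m + (n - κ m)))
    (fun n hn => (if_pos hn).symm) (by simpa using hrk m) ⟨fun _ => trivial, fun a b hab h => ?_⟩
  dsimp only at h
  split_ifs at h with ha hb hb
  · exact hbad.2 a b hab h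
  · exact hbad.2 a _ (ha.trans_le (hm _)) (_root_.trans h (hκ _))
  · omega
  · exact hcon _ _ (by omega) h

/-- A finite planar forest with vertices labelled in `L`. The tree structure is recorded by the
ancestor relation `anc`, the planar structure by the depth-first numbering `ord`. In such a numbering
the descendants of a vertex form an interval that starts at the vertex; these conditions alone already
force the ancestors of each vertex to be a chain. -/
structure LabelledForest (L : Type u) where
  /-- the vertices -/
  V : Type
  [finite : Finite V]
  /-- the depth-first numbering -/
  ord : V → ℕ
  /-- `anc a b` means that `a` is an ancestor of `b`, or `b` itself -/
  anc : V → V → Prop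
  /-- the labels of the vertices -/
  lab : V → L
  ord_injective : Function.Injective ord
  anc_refl : ∀ a, anc a a
  anc_trans : ∀ a b c, anc a b → anc b c → anc a c
  ord_le : ∀ a b, anc a b → ord a ≤ ord b
  anc_of_ord : ∀ a b c, ord a ≤ ord b → ord b ≤ ord c → anc a c → anc a b

attribute [instance] LabelledForest.finite

namespace LabelledForest

variable {L : Type u}

/-- `h` embeds the part `A` of the forest `X` into the part `B` of the forest `Y`: it preserves the
labels and the depth-first order, and preserves and reflects the ancestor relation. -/
structure IsEmbedding (X Y : LabelledForest L) (A : Set X.V) (B : Set Y.V) (h : X.V → Y.V) :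
    Prop where
  mem : ∀ a ∈ A, h a ∈ B
  lab : ∀ a ∈ A, Y.lab (h a) = X.lab a
  lt : ∀ a ∈ A, ∀ b ∈ A, X.ord a < X.ord b → Y.ord (h a) < Y.ord (h b)
  anc : ∀ a ∈ A, ∀ b ∈ A, X.anc a b ↔ Y.anc (h a) (h b)

/-- The parts of labelled forests; a part is a forest in its own right. -/
abbrev Part (L : Type u) : Type (max u 1) := Σ X : LabelledForest L, Set X.V

/-- One part embeds into another. The empty part is treated separately, because there is no map
between the vertex sets if only the target forest has no vertices. -/
def Embeds (p q : Part L) : Prop := p.2 = ∅ ∨ ∃ h, IsEmbedding p.1 q.1 p.2 q.2 h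

theorem Embeds.of_subset {X : LabelledForest L} {A B : Set X.V} (h : A ⊆ B) :
    Embeds ⟨X, A⟩ ⟨X, B⟩ :=
  Or.inr ⟨fun a => a, h, fun _ _ => rfl, fun _ _ _ _ h => h, fun _ _ _ _ => Iff.rfl⟩

instance : IsPreorder (Part L) Embeds where
  refl _ := Embeds.of_subset subset_rfl
  trans := by
    rintro ⟨X, A⟩ ⟨Y, B⟩ ⟨Z, D⟩ h1 h2
    rcases h1 with h1 | ⟨h, hh⟩
    · exact Or.inl h1
    rcases h2 with h2 | ⟨g, hg⟩
    · refine Or.inl (Set.eq_empty_of_forall_notMem fun a ha => ?_)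
      have := hh.mem a ha
      simp_all
    · exact Or.inr ⟨fun a => g (h a), fun a ha => hg.mem _ (hh.mem a ha),
        fun a ha => (hg.lab _ (hh.mem a ha)).trans (hh.lab a ha),
        fun a ha b hb hab => hg.lt _ (hh.mem a ha) _ (hh.mem b hb) (hh.lt a ha b hb hab),
        fun a ha b hb => (hh.anc a ha b hb).trans (hg.anc _ (hh.mem a ha) _ (hh.mem b hb))⟩

/-- The proper descendants of `a` in the part `A`. -/
def below (X : LabelledForest L) (A : Set X.V) (a : X.V) : Set X.V :=
  {x | x ∈ A ∧ X.anc a x ∧ x ≠ a}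

/-- The vertices of the part `A` that do not descend from `a`. -/
def beside (X : LabelledForest L) (A : Set X.V) (a : X.V) : Set X.V :=
  {x | x ∈ A ∧ ¬ X.anc a x}

theorem below_subset (X : LabelledForest L) (A : Set X.V) (a : X.V) : X.below A a ⊆ A :=
  fun _ h => h.1

theorem beside_subset (X : LabelledForest L) (A : Set X.V) (a : X.V) : X.beside A a ⊆ A :=
  fun _ h => h.1

/-- If `a` and `b` are the first vertices of `A` and `B` and have the same label, then embeddings of
the descendants and of the remaining vertices glue to an embedding of `A` into `B`. -/
theorem Embeds.glue {X Y : LabelledForest L} {A : Set X.V} {B : Set Y.V} {a : X.V} {b : Y.V}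
    (hb : b ∈ B) (ha' : ∀ x ∈ A, X.ord a ≤ X.ord x)
    (hb' : ∀ y ∈ B, Y.ord b ≤ Y.ord y) (hlab : Y.lab b = X.lab a)
    (h1 : Embeds ⟨X, X.below A a⟩ ⟨Y, Y.below B b⟩)
    (h2 : Embeds ⟨X, X.beside A a⟩ ⟨Y, Y.beside B b⟩) : Embeds ⟨X, A⟩ ⟨Y, B⟩ := by
  classical
  have ex : ∀ {C D}, Embeds ⟨X, C⟩ ⟨Y, D⟩ → ∃ h, IsEmbedding X Y C D h := by
    rintro C D (h | h)
    · obtain rfl : C = (∅ : Set X.V) := h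
      exact ⟨fun _ => b, by simp, by simp, by simp, by simp⟩
    · exact h
  obtain ⟨g, hg⟩ := ex h1
  obtain ⟨k, hk⟩ := ex h2
  let h : X.V → Y.V := fun x => if x = a then b else if X.anc a x then g x else k x
  have cases : ∀ x ∈ A, (x = a ∧ h x = b) ∨
      (x ∈ X.below A a ∧ h x = g x ∧ h x ∈ Y.below B b) ∨
      (x ∈ X.beside A a ∧ h x = k x ∧ h x ∈ Y.beside B b) := by
    intro x hx
    by_cases h1 : x = a
    · exact Or.inl ⟨h1, if_pos h1⟩
    by_cases h2 : X.anc a x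
    · have hx' : x ∈ X.below A a := ⟨hx, h2, h1⟩
      have e : h x = g x := by simp [h, h1, h2]
      exact Or.inr (Or.inl ⟨hx', e, e ▸ hg.mem x hx'⟩)
    · have hx' : x ∈ X.beside A a := ⟨hx, h2⟩
      have e : h x = k x := by simp [h, h1, h2]
      exact Or.inr (Or.inr ⟨hx', e, e ▸ hk.mem x hx'⟩)
  have ltb : ∀ y ∈ B, y ≠ b → Y.ord b < Y.ord y := fun y hy hne =>
    lt_of_le_of_ne (hb' y hy) fun e => hne (Y.ord_injective e.symm)
  have not_anc : ∀ x ∈ A, x ≠ a → ¬ X.anc x a := fun x hx hne e =>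
    hne (X.ord_injective (le_antisymm (X.ord_le _ _ e) (ha' x hx)))
  have not_anc' : ∀ y ∈ B, y ≠ b → ¬ Y.anc y b := fun y hy hne e =>
    hne (Y.ord_injective (le_antisymm (Y.ord_le _ _ e) (hb' y hy)))
  have nea : ∀ x ∈ X.beside A a, x ≠ a := fun x hx e => hx.2 (e ▸ X.anc_refl x)
  have neb : ∀ y ∈ Y.beside B b, y ≠ b := fun y hy e => hy.2 (e ▸ Y.anc_refl y)
  -- A vertex beside the first one is incomparable to the descendants of the first one.
  have inca : ∀ x ∈ X.below A a, ∀ y ∈ X.beside A a,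
      X.ord x < X.ord y ∧ ¬ X.anc x y ∧ ¬ X.anc y x := by
    intro x hx y hy
    have hlt : X.ord x < X.ord y := by
      by_contra hle
      exact hy.2 (X.anc_of_ord a y x (ha' y hy.1) (not_lt.1 hle) hx.2.1)
    exact ⟨hlt, fun e => hy.2 (X.anc_trans _ _ _ hx.2.1 e),
      fun e => absurd (X.ord_le _ _ e) (not_le.2 hlt)⟩
  have incb : ∀ x ∈ Y.below B b, ∀ y ∈ Y.beside B b,
      Y.ord x < Y.ord y ∧ ¬ Y.anc x y ∧ ¬ Y.anc y x := by
    intro x hx y hy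
    have hlt : Y.ord x < Y.ord y := by
      by_contra hle
      exact hy.2 (Y.anc_of_ord b y x (hb' y hy.1) (not_lt.1 hle) hx.2.1)
    exact ⟨hlt, fun e => hy.2 (Y.anc_trans _ _ _ hx.2.1 e),
      fun e => absurd (Y.ord_le _ _ e) (not_le.2 hlt)⟩
  refine Or.inr ⟨h, ?_, ?_, ?_, ?_⟩
  · intro x hx
    rcases cases x hx with ⟨-, e⟩ | ⟨-, -, e⟩ | ⟨-, -, e⟩
    · exact e.symm ▸ hb
    · exact e.1
    · exact e.1
  · intro x hx
    rcases cases x hx with ⟨e1, e2⟩ | ⟨e1, e2, -⟩ | ⟨e1, e2, -⟩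
    · rw [e2, e1]; exact hlab
    · rw [e2]; exact hg.lab x e1
    · rw [e2]; exact hk.lab x e1
  · intro x hx y hy hxy
    rcases cases x hx with ⟨e1, e2⟩ | ⟨e1, e2, e3⟩ | ⟨e1, e2, e3⟩ <;>
    rcases cases y hy with ⟨d1, d2⟩ | ⟨d1, d2, d3⟩ | ⟨d1, d2, d3⟩
    · subst e1; subst d1; exact absurd hxy (lt_irrefl _)
    · rw [e2]; exact ltb _ d3.1 d3.2.2
    · rw [e2]; exact ltb _ d3.1 (neb _ d3)
    · subst d1; exact absurd hxy (not_lt.2 (ha' x hx))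
    · rw [e2, d2]; exact hg.lt x e1 y d1 hxy
    · exact (incb _ e3 _ d3).1
    · subst d1; exact absurd hxy (not_lt.2 (ha' x hx))
    · exact absurd hxy (not_lt.2 (inca y d1 x e1).1.le)
    · rw [e2, d2]; exact hk.lt x e1 y d1 hxy
  · intro x hx y hy
    rcases cases x hx with ⟨e1, e2⟩ | ⟨e1, e2, e3⟩ | ⟨e1, e2, e3⟩ <;>
    rcases cases y hy with ⟨d1, d2⟩ | ⟨d1, d2, d3⟩ | ⟨d1, d2, d3⟩
    · rw [e2, d2, e1, d1]; exact iff_of_true (X.anc_refl _) (Y.anc_refl _)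
    · rw [e2, e1]; exact iff_of_true d1.2.1 d3.2.1
    · rw [e2, e1]; exact iff_of_false d1.2 d3.2
    · rw [d2, d1]; exact iff_of_false (not_anc x hx e1.2.2) (not_anc' _ e3.1 e3.2.2)
    · rw [e2, d2]; exact hg.anc x e1 y d1
    · exact iff_of_false (inca x e1 y d1).2.1 (incb _ e3 _ d3).2.1
    · rw [d2, d1]; exact iff_of_false (not_anc x hx (nea x e1)) (not_anc' _ e3.1 (neb _ e3))
    · exact iff_of_false (inca y d1 x e1).2.2 (incb _ d3 _ e3).2.2
    · rw [e2, d2]; exact hk.anc x e1 y d1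

/-- Kruskal's tree theorem for planar forests with finitely many labels, in the weak form in which
embeddings need not preserve infima. Splitting a forest into its first vertex, the descendants of
that vertex, and the rest, reduces it to the corresponding fact for binary trees. -/
theorem wellQuasiOrdered_embeds [Finite L] : WellQuasiOrdered (Embeds (L := L)) := by
  rw [← Set.partiallyWellOrderedOn_univ_iff,
    Set.PartiallyWellOrderedOn.iff_not_exists_isMinBadSeq (fun p : Part L => p.2.ncard)]
  rintro ⟨f, hbad, hmin⟩
  have hne : ∀ n, (f n).2.Nonempty := fun n => by
    by_contra hn
    exact hbad.2 n (n + 1) (Nat.lt_succ_self n) (Or.inl (Set.not_nonempty_iff_eq_empty.1 hn))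
  choose a ha ha' using fun n =>
    Set.exists_min_image (f n).2 (f n).1.ord (Set.toFinite _) (hne n)
  have hD := partiallyWellOrderedOn_below_minBadSeq hbad hmin
  have card_lt : ∀ (n : ℕ) (A : Set (f n).1.V), A ⊆ (f n).2 → a n ∉ A →
      A.ncard < (f n).2.ncard := fun n A hA hn =>
    Set.ncard_lt_ncard ⟨hA, fun h => hn (h (ha n))⟩ (Set.toFinite _)
  have hlab : (Set.univ : Set L).PartiallyWellOrderedOn (· = ·) :=
    Set.finite_univ.partiallyWellOrderedOn
  obtain ⟨i, j, hij, h3, h1, h2⟩ := (hlab.prod (hD.prod hD)).exists_lt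
    (f := fun n => ((f n).1.lab (a n), (⟨(f n).1, (f n).1.below (f n).2 (a n)⟩ : Part L),
      (⟨(f n).1, (f n).1.beside (f n).2 (a n)⟩ : Part L)))
    (fun n => ⟨trivial, ⟨n, Embeds.of_subset (below_subset _ _ _),
        card_lt n _ (below_subset _ _ _) fun h => h.2.2 rfl⟩,
      ⟨n, Embeds.of_subset (beside_subset _ _ _),
        card_lt n _ (beside_subset _ _ _) fun h => h.2 ((f n).1.anc_refl _)⟩⟩)
  exact hbad.2 i j hij (Embeds.glue (ha j) (ha' i) (ha' j) h3.symm h1 h2)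

end LabelledForest

/-! ### Depth-first orders on trees -/

theorem List.nat_cons_le_cons_iff {x y : ℕ} {a b : List ℕ} :
    x :: a ≤ y :: b ↔ x < y ∨ x = y ∧ a ≤ b := by
  rw [← not_lt, ← not_lt (a := b), List.cons_lt_cons_iff]
  rcases lt_trichotomy x y with h | rfl | h
  · simp [h, h.not_gt, h.ne']
  · simp
  · simp [h, h.not_gt, h.ne']

theorem List.isPrefix_of_le_of_le {a b c : List ℕ} (hab : a ≤ b) (hbc : b ≤ c) (hac : a <+: c) :
    a <+: b := by
  induction a generalizing b c with
  | nil => exact List.nil_prefix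
  | cons x a ih =>
    obtain ⟨t, rfl⟩ := hac
    cases b with
    | nil => exact absurd hab (by simp)
    | cons y b =>
      rw [List.cons_append, List.nat_cons_le_cons_iff] at hbc
      rw [List.nat_cons_le_cons_iff] at hab
      obtain rfl : x = y := by omega
      simp only [lt_irrefl, true_and, false_or] at hab hbc
      exact List.cons_prefix_cons.2 ⟨rfl, ih hab hbc (List.prefix_append _ _)⟩

theorem List.IsPrefix.le_of_nat {a b : List ℕ} (h : a <+: b) : a ≤ b := by
  induction a generalizing b with
  | nil => exact not_lt.1 (List.not_lt_nil _)
  | cons x a ih =>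
    obtain ⟨t, rfl⟩ := h
    rw [List.cons_append, List.nat_cons_le_cons_iff]
    exact Or.inr ⟨rfl, ih (List.prefix_append _ _)⟩

theorem List.map_lt_map_of_forall {α : Type*} {u u' v v' : α → ℕ} (l : List α)
    (hlt : ∀ a, u a < u' a → v a < v' a) (heq : ∀ a, u a = u' a → v a = v' a)
    (h : l.map u < l.map u') : l.map v < l.map v' := by
  induction l with
  | nil => exact absurd h (by simp)
  | cons a l ih =>
    rw [List.map_cons, List.map_cons, List.cons_lt_cons_iff] at h ⊢
    exact h.imp (hlt a) fun h => ⟨heq a h.1, ih h.2⟩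

/-- Vertices of a finite set can be numbered compatibly with any map to a linear order. -/
theorem exists_nat_numbering {V K : Type*} [Finite V] [LinearOrder K] (P : V → K) :
    ∃ ord : V → ℕ, ∀ a b, ord a ≤ ord b ↔ P a ≤ P b := by
  have hlt : ∀ a b, P a < P b → {w | P w < P a}.ncard < {w | P w < P b}.ncard := fun a b h =>
    Set.ncard_lt_ncard ⟨fun w (hw : P w < P a) => hw.trans h,
      fun hs => lt_irrefl _ (hs (show a ∈ {w | P w < P b} from h))⟩ (Set.toFinite _)
  refine ⟨fun a => {w | P w < P a}.ncard, fun a b => ⟨fun h => ?_, fun h => ?_⟩⟩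
  · exact not_lt.1 fun h' => absurd (hlt _ _ h') (not_lt.2 h)
  · exact Set.ncard_le_ncard (fun w (hw : P w < P a) => hw.trans_le h) (Set.toFinite _)

namespace FinTree

/-- The ancestor relation of the tree `T` rooted at `r`: `a` is an ancestor of `b`, or `b` itself,
if `a` lies on all walks from `r` to `b`. -/
def Anc (T : FinTree) (r a b : T.V) : Prop := ∀ p : T.graph.Walk r b, a ∈ p.support

section Anc

variable {T : FinTree} {r a b c m : T.V}

theorem Anc.refl : T.Anc r a a := fun p => p.end_mem_support

theorem Anc.root : T.Anc r r a := fun p => p.start_mem_support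

theorem Anc.trans (h1 : T.Anc r a b) (h2 : T.Anc r b c) : T.Anc r a c := by
  classical
  intro p
  exact p.support_takeUntil_subset_support (h2 p) (h1 (p.takeUntil b (h2 p)))

theorem Anc.of_adj (hab : T.graph.Adj a b) (h : T.Anc r m a) : T.Anc r m b ∨ m = a := by
  by_contra! hcon
  obtain ⟨h1, h2⟩ := hcon
  obtain ⟨q, hq⟩ := not_forall.1 h1
  have := h (q.concat hab.symm)
  rw [SimpleGraph.Walk.support_concat] at this
  simp_all

/-- Of two adjacent vertices of a tree, one is an ancestor of the other: otherwise the edge between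
them would lie on a cycle through the root. -/
theorem anc_or_anc_of_adj (r : T.V) (hab : T.graph.Adj a b) : T.Anc r a b ∨ T.Anc r b a := by
  by_contra! hcon
  obtain ⟨h1, h2⟩ := hcon
  obtain ⟨q, hq⟩ := not_forall.1 h1
  obtain ⟨p, hp⟩ := not_forall.1 h2
  have hb := SimpleGraph.isBridge_iff_forall_walk_mem_edges.1
    (SimpleGraph.isAcyclic_iff_forall_adj_isBridge.1 T.isTree.isAcyclic hab) (p.reverse.append q)
  rw [SimpleGraph.Walk.edges_append, List.mem_append, SimpleGraph.Walk.edges_reverse,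
    List.mem_reverse] at hb
  rcases hb with hb | hb
  · exact hp (p.snd_mem_support_of_mem_edges hb)
  · exact hq (q.fst_mem_support_of_mem_edges hb)

theorem Anc.eq_root (h : T.Anc r a r) : a = r := by
  simpa using h SimpleGraph.Walk.nil

/-- Every vertex other than the root has a parent. -/
theorem exists_parent (hb : b ≠ r) : ∃ p, T.graph.Adj p b ∧ T.Anc r p b := by
  have key : ∀ {u v : T.V} (_ : T.graph.Walk u v), v = b → ¬ T.Anc r b u →
      ∃ p, T.graph.Adj p b ∧ T.Anc r p b := by
    intro u v p
    induction p with
    | nil => rintro rfl h; exact absurd Anc.refl h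
    | @cons u w v h p ih =>
      intro hv hu
      by_cases hw : T.Anc r b w
      · obtain rfl := (hw.of_adj h.symm).resolve_left hu
        exact ⟨u, h, (anc_or_anc_of_adj r h).resolve_right hu⟩
      · exact ih hv hw
  obtain ⟨p⟩ := T.isTree.connected.preconnected r b
  exact key p rfl fun h => hb h.eq_root

/-- Paths from the root, as words in a numbering of the vertices, turn the ancestor relation into
the prefix relation. -/
theorem exists_path_words (T : FinTree) (r : T.V) :
    ∃ P : T.V → List ℕ, Function.Injective P ∧ ∀ a b, T.Anc r a b ↔ P a <+: P b := by
  classical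
  obtain ⟨n, ⟨ν⟩⟩ := Finite.exists_equiv_fin T.V
  have hν : Function.Injective fun v => (ν v : ℕ) := Fin.val_injective.comp ν.injective
  choose p hp hu using fun v => T.isTree.existsUnique_path r v
  have hanc : ∀ a b, T.Anc r a b ↔
      (p a).support.map (fun v => (ν v : ℕ)) <+: (p b).support.map (fun v => (ν v : ℕ)) := by
    intro a b
    constructor
    · intro h
      have h1 : (p b).takeUntil a (h (p b)) = p a := hu a _ ((hp b).takeUntil _)
      have h2 := congrArg SimpleGraph.Walk.support ((p b).take_spec (h (p b)))
      rw [SimpleGraph.Walk.support_append, h1] at h2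
      exact List.IsPrefix.map _ ⟨_, h2⟩
    · intro h q
      have h1 : (ν a : ℕ) ∈ (p b).support.map (fun v => (ν v : ℕ)) :=
        h.subset (List.mem_map_of_mem (p a).end_mem_support)
      have h2 : a ∈ (p b).support := (List.mem_map_of_injective hν).1 h1
      rw [← hu b q.bypass q.bypass_isPath] at h2
      exact q.support_bypass_subset_support h2
  refine ⟨_, fun a b h => ?_, hanc⟩
  have h1 := List.map_injective_iff.2 hν h
  have h2 := congrArg List.getLast? h1
  rwa [List.getLast?_eq_getLast_of_ne_nil (p a).support_ne_nil,
    List.getLast?_eq_getLast_of_ne_nil (p b).support_ne_nil, SimpleGraph.Walk.getLast_support,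
    SimpleGraph.Walk.getLast_support, Option.some_inj] at h2

end Anc

/-- A rooting of the tree `T` with a depth-first numbering of its vertices: descendants come after
their ancestors, and the descendants of each vertex are numbered consecutively, up to gaps. -/
structure DFSOrder (T : FinTree) where
  /-- the root -/
  root : T.V
  /-- the numbering -/
  ord : T.V → ℕ
  ord_injective : Function.Injective ord
  ord_le : ∀ a b, T.Anc root a b → ord a ≤ ord b
  anc_of_ord : ∀ a b c, ord a ≤ ord b → ord b ≤ ord c → T.Anc root a c → T.Anc root a b

/-- The lexicographic order of the paths from the root is a depth-first order. -/
theorem exists_dfsOrder (T : FinTree) (r : T.V) : ∃ o : DFSOrder T, o.root = r := by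
  obtain ⟨P, hP, hanc⟩ := T.exists_path_words r
  obtain ⟨ord, hord⟩ := exists_nat_numbering P
  refine ⟨⟨r, ord, fun a b h => ?_, fun a b h => ?_, fun a b c h1 h2 h3 => ?_⟩, rfl⟩
  · exact hP (le_antisymm ((hord a b).1 h.le) ((hord b a).1 h.ge))
  · exact (hord a b).2 ((hanc a b).1 h).le_of_nat
  · exact (hanc a b).2
      (List.isPrefix_of_le_of_le ((hord a b).1 h1) ((hord b c).1 h2) ((hanc a c).1 h3))

theorem Anc.antisymm {T : FinTree} {r a b : T.V} (h1 : T.Anc r a b) (h2 : T.Anc r b a) :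
    a = b := by
  obtain ⟨P, hP, hanc⟩ := T.exists_path_words r
  have h := ((hanc _ _).1 h1)
  exact hP (h.eq_of_length (le_antisymm h.length_le ((hanc _ _).1 h2).length_le))

theorem eq_of_anc_iff {T : FinTree} {r x y : T.V} (h : ∀ a, T.Anc r a x ↔ T.Anc r a y) : x = y :=
  ((h x).1 .refl).antisymm ((h y).2 .refl)

/-- The strict ancestors of a vertex are the ancestors of its parent. -/
theorem anc_parent_iff {T : FinTree} {r a b p : T.V} (hadj : T.graph.Adj p b) (hp : T.Anc r p b) :
    T.Anc r a p ↔ T.Anc r a b ∧ a ≠ b := by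
  constructor
  · refine fun h => ⟨h.trans hp, ?_⟩
    rintro rfl
    exact hadj.ne (hp.antisymm h)
  · rintro ⟨h, hne⟩
    exact (h.of_adj hadj.symm).resolve_right hne

/-! ### Contractions as Galois adjoints -/

namespace Contraction

variable {R S T : FinTree}

/-- A contraction maps a walk to a walk, possibly with repeated vertices left out. -/
theorem exists_walk_map (f : Contraction T S) {a b : T.V} (p : T.graph.Walk a b) :
    ∃ q : S.graph.Walk (f.toFun a) (f.toFun b), ∀ s ∈ q.support, ∃ x ∈ p.support, f.toFun x = s := by
  induction p with
  | nil => exact ⟨.nil, by simp⟩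
  | @cons u w v h p ih =>
    obtain ⟨q, hq⟩ := ih
    rcases f.map_adj _ _ h with h1 | h1
    · rw [h1]
      refine ⟨q, fun s hs => ?_⟩
      obtain ⟨x, hx, e⟩ := hq s hs
      exact ⟨x, by simp [hx], e⟩
    · refine ⟨.cons h1 q, fun s hs => ?_⟩
      rw [SimpleGraph.Walk.support_cons, List.mem_cons] at hs
      rcases hs with rfl | hs
      · exact ⟨u, by simp, rfl⟩
      · obtain ⟨x, hx, e⟩ := hq s hs
        exact ⟨x, by simp [hx], e⟩

theorem anc_map (f : Contraction T S) {r a b : T.V} (h : T.Anc r a b) :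
    S.Anc (f.toFun r) (f.toFun a) (f.toFun b) := by
  intro q
  have hc := f.connected_preimage {s | s ∈ q.support} q.connected_induce_support
  obtain ⟨p⟩ := hc.preconnected ⟨r, q.start_mem_support⟩ ⟨b, q.end_mem_support⟩
  have key : ∀ {A : Set T.V} {u v : A} (p : (T.graph.induce A).Walk u v),
      ∀ x ∈ (p.map (SimpleGraph.Embedding.induce A).toHom).support, x ∈ A := by
    intro A u v p x hx
    rw [SimpleGraph.Walk.support_map, List.mem_map] at hx
    obtain ⟨y, -, rfl⟩ := hx
    exact y.2
  exact key p _ (h _)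

instance : Finite (S ⟶ T) :=
  Finite.of_injective (fun f : Contraction S T => f.toFun) fun _ _ h => Contraction.ext h

end Contraction

namespace DFSOrder

variable {R S T : FinTree} (o : DFSOrder T)

/-- The first vertex of a subtree is an ancestor of all its vertices. -/
theorem anc_of_connected {A : Set T.V} (hA : (T.graph.induce A).Connected) {m : T.V} (hm : m ∈ A)
    (hmin : ∀ x ∈ A, o.ord m ≤ o.ord x) {x : T.V} (hx : x ∈ A) : T.Anc o.root m x := by
  have key : ∀ {u v : A}, (T.graph.induce A).Walk u v → T.Anc o.root m u → T.Anc o.root m v := by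
    intro u v p
    induction p with
    | nil => exact id
    | @cons u w v h p ih =>
      intro hu
      refine ih ?_
      have hadj : T.graph.Adj u w := h
      rcases hu.of_adj hadj with h1 | rfl
      · exact h1
      · refine (anc_or_anc_of_adj o.root hadj).resolve_right fun h1 => hadj.ne ?_
        exact o.ord_injective (le_antisymm (hmin _ w.2) (o.ord_le _ _ h1))
  obtain ⟨p⟩ := hA.preconnected ⟨m, hm⟩ ⟨x, hx⟩
  exact key p .refl

theorem exists_first (f : Contraction T S) (s : S.V) :
    ∃ t, f.toFun t = s ∧ ∀ t', f.toFun t' = s → o.ord t ≤ o.ord t' := by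
  obtain ⟨⟨t, ht⟩⟩ := (f.connected_fiber s).nonempty
  exact Set.exists_min_image {t | f.toFun t = s} o.ord (Set.toFinite _) ⟨t, ht⟩

/-- The section of a contraction that takes a vertex to the first vertex in its fibre. -/
noncomputable def sec (f : Contraction T S) (s : S.V) : T.V := (o.exists_first f s).choose

@[simp]
theorem map_sec (f : Contraction T S) (s : S.V) : f.toFun (o.sec f s) = s :=
  (o.exists_first f s).choose_spec.1

theorem ord_sec_le (f : Contraction T S) {t : T.V} {s : S.V} (h : f.toFun t = s) :
    o.ord (o.sec f s) ≤ o.ord t :=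
  (o.exists_first f s).choose_spec.2 t h

theorem sec_eq (f : Contraction T S) {t : T.V} {s : S.V} (h : f.toFun t = s)
    (hmin : ∀ t', f.toFun t' = s → o.ord t ≤ o.ord t') : o.sec f s = t :=
  o.ord_injective (le_antisymm (o.ord_sec_le f h) (hmin _ (o.map_sec f s)))

theorem sec_root (f : Contraction T S) : o.sec f (f.toFun o.root) = o.root :=
  o.sec_eq f rfl fun _ _ => o.ord_le _ _ .root

/-- The section is left adjoint to the contraction. -/
theorem sec_anc_iff (f : Contraction T S) {s : S.V} {t : T.V} :
    T.Anc o.root (o.sec f s) t ↔ S.Anc (f.toFun o.root) s (f.toFun t) := by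
  classical
  constructor
  · intro h
    simpa using f.anc_map h
  · intro h p
    obtain ⟨q, hq⟩ := f.exists_walk_map p
    obtain ⟨x, hx, hxs⟩ := hq s (h q)
    have h1 := o.anc_of_connected (f.connected_fiber s) (o.map_sec f s)
      (fun t ht => o.ord_sec_le f ht) hxs
    exact p.support_takeUntil_subset_support hx (h1 (p.takeUntil x hx))

/-- A contraction is determined by its section, being its right adjoint. -/
theorem eq_of_sec_eq {f g : Contraction T S} (h : ∀ s, o.sec f s = o.sec g s) : f = g := by
  have hr : f.toFun o.root = g.toFun o.root := by
    conv_rhs => rw [← o.sec_root f, h, o.map_sec]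
  refine Contraction.ext (funext fun t => eq_of_anc_iff (r := f.toFun o.root) fun s => ?_)
  rw [← o.sec_anc_iff, h, o.sec_anc_iff, hr]

/-! ### Contractions from embeddings of trees -/

variable {o} {o' : DFSOrder S} {h : S.V → T.V}

/-- `h` embeds the ordered tree `S` into the ordered tree `T`. -/
structure IsEmbedding (o' : DFSOrder S) (o : DFSOrder T) (h : S.V → T.V) : Prop where
  root : h o'.root = o.root
  lt : ∀ a b, o'.ord a < o'.ord b → o.ord (h a) < o.ord (h b)
  anc : ∀ a b, S.Anc o'.root a b ↔ T.Anc o.root (h a) (h b)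

theorem IsEmbedding.le (hh : IsEmbedding o' o h) {a b : S.V} (hab : o'.ord a ≤ o'.ord b) :
    o.ord (h a) ≤ o.ord (h b) := by
  rcases hab.lt_or_eq with h1 | h1
  · exact (hh.lt _ _ h1).le
  · rw [o'.ord_injective h1]

theorem IsEmbedding.exists_adjoint (hh : IsEmbedding o' o h) :
    ∃ φ : T.V → S.V, ∀ t a, T.Anc o.root (h a) t ↔ S.Anc o'.root a (φ t) := by
  choose φ hφ hmax using fun t => Set.exists_max_image {a | T.Anc o.root (h a) t} o'.ord
    (Set.toFinite _) ⟨o'.root, by rw [Set.mem_ofPred_eq, hh.root]; exact .root⟩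
  refine ⟨φ, fun t a => ⟨fun ha => ?_, fun ha => ((hh.anc _ _).1 ha).trans (hφ t)⟩⟩
  exact (hh.anc _ _).2 (o.anc_of_ord _ _ _ (hh.le (hmax t a ha)) (o.ord_le _ _ (hφ t)) ha)

/-- The right adjoint of an embedding of trees is a contraction. -/
theorem IsEmbedding.exists_contraction (hh : IsEmbedding o' o h) :
    ∃ φ : Contraction T S, ∀ a, o.sec φ a = h a := by
  obtain ⟨φ, gc⟩ := hh.exists_adjoint
  have φh : ∀ a, φ (h a) = a := fun a => eq_of_anc_iff fun b => by rw [← gc, ← hh.anc]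
  -- The right adjoint takes a parent and its child to the same vertex or to a parent and its child.
  have parent_same : ∀ {p t}, T.graph.Adj p t → T.Anc o.root p t → (∀ a, h a ≠ t) → φ p = φ t := by
    intro p t hadj hp hne
    refine eq_of_anc_iff (r := o'.root) fun a => ?_
    rw [← gc, ← gc, anc_parent_iff hadj hp, and_iff_left (hne a)]
  have parent_adj : ∀ {p a}, T.graph.Adj p (h a) → T.Anc o.root p (h a) →
      S.graph.Adj (φ p) a := by
    intro p a hadj hp
    obtain ⟨q, hq, hqa⟩ := exists_parent (r := o'.root) (b := a) fun e => by
      rw [e, hh.root] at hadj hp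
      exact hadj.ne hp.eq_root
    have : φ p = q := eq_of_anc_iff (r := o'.root) fun b => by
      rw [← gc, anc_parent_iff hadj hp, anc_parent_iff hq hqa, ← hh.anc]
      exact and_congr_right fun _ => not_congr ⟨fun e => by rw [← φh b, e, φh], fun e => e ▸ rfl⟩
    rwa [this]
  have map_parent : ∀ {p t}, T.graph.Adj p t → T.Anc o.root p t →
      φ p = φ t ∨ S.graph.Adj (φ p) (φ t) := by
    intro p t hadj hp
    by_cases ht : ∃ a, h a = t
    · obtain ⟨a, rfl⟩ := ht
      rw [φh]
      exact Or.inr (parent_adj hadj hp)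
    · exact Or.inl (parent_same hadj hp (not_exists.1 ht))
  have reach : ∀ (a : S.V) (n : ℕ) (t : T.V) (ht : φ t = a), o.ord t = n →
      (T.graph.induce {t | φ t = a}).Reachable ⟨t, ht⟩ ⟨h a, φh a⟩ := by
    intro a n
    induction n using Nat.strong_induction_on with
    | _ n ih =>
      intro t ht hn
      by_cases hta : ∃ b, h b = t
      · obtain ⟨b, rfl⟩ := hta
        rw [φh] at ht
        subst ht
        exact SimpleGraph.Reachable.refl _
      obtain ⟨p, hadj, hp⟩ := exists_parent (r := o.root) (b := t)
        fun e => hta ⟨_, hh.root.trans e.symm⟩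
      have hpa : φ p = a := (parent_same hadj hp (not_exists.1 hta)).trans ht
      have hlt : o.ord p < n := hn ▸ lt_of_le_of_ne (o.ord_le _ _ hp)
        fun e => hadj.ne (o.ord_injective e)
      refine SimpleGraph.Reachable.trans (SimpleGraph.Adj.reachable ?_) (ih _ hlt p hpa rfl)
      exact SimpleGraph.comap_adj.2 hadj.symm
  refine ⟨⟨φ, fun a b hab => ?_, fun a => ?_⟩, fun a => ?_⟩
  · rcases anc_or_anc_of_adj o.root hab with h1 | h1
    · exact map_parent hab h1
    · exact (map_parent hab.symm h1).imp Eq.symm SimpleGraph.Adj.symm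
  · have : Nonempty {t | φ t = a} := ⟨⟨h a, φh a⟩⟩
    exact ⟨fun x y => (reach a _ x.1 x.2 rfl).trans (reach a _ y.1 y.2 rfl).symm⟩
  · exact o.sec_eq _ (φh a) fun t ht => o.ord_le _ _ ((gc t a).2 (ht ▸ .refl))

/-- Sections compose contravariantly. -/
theorem IsEmbedding.sec_comp (hh : IsEmbedding o' o h) {φ : Contraction T S}
    (hφ : ∀ a, o.sec φ a = h a) (f : Contraction S R) (s : R.V) :
    o.sec (φ.comp f) s = h (o'.sec f s) := by
  refine o.sec_eq _ ?_ fun t ht => ?_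
  · change f.toFun (φ.toFun _) = s
    rw [← hφ, o.map_sec, o'.map_sec]
  · exact (hh.le (o'.ord_sec_le f ht)).trans (hφ _ ▸ o.ord_sec_le φ rfl)

/-- The word that encodes a contraction: the numbers of the vertices of its section. Words are
compared lexicographically. -/
noncomputable def key (o : DFSOrder T) (f : Contraction T S) : List ℕ :=
  (@Finset.univ S.V (Fintype.ofFinite _)).toList.map fun s => o.ord (o.sec f s)

theorem key_injective (o : DFSOrder T) : Function.Injective (o.key : Contraction T S → List ℕ) := by
  intro f g hfg
  refine o.eq_of_sec_eq fun s => o.ord_injective ?_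
  exact List.map_inj_left.1 hfg s (by simp)

theorem IsEmbedding.key_lt (hh : IsEmbedding o' o h) {φ : Contraction T S}
    (hφ : ∀ a, o.sec φ a = h a) {f g : Contraction S R} (hfg : o'.key f < o'.key g) :
    o.key (φ.comp f) < o.key (φ.comp g) := by
  refine List.map_lt_map_of_forall _ (fun s hs => ?_) (fun s hs => ?_) hfg
  · rw [hh.sec_comp hφ, hh.sec_comp hφ]
    exact hh.lt _ _ hs
  · rw [hh.sec_comp hφ, hh.sec_comp hφ, o'.ord_injective hs]

/-- The forest that consists of one ordered tree `T`, with the following labels: the root is marked,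
and the vertices in the section of `f` are marked with the corresponding vertices of `S`. -/
noncomputable def toLabelledForest (o : DFSOrder T) (f : Contraction T S) :
    LabelledForest (Set S.V × Prop) where
  V := T.V
  ord := o.ord
  anc := T.Anc o.root
  lab t := ({s | o.sec f s = t}, t = o.root)
  ord_injective := o.ord_injective
  anc_refl _ := .refl
  anc_trans _ _ _ := .trans
  ord_le := o.ord_le
  anc_of_ord := o.anc_of_ord

/-- Contractions to a fixed tree `S` are well-quasi-ordered by divisibility: Kruskal's theorem
provides an embedding compatible with the sections, and its right adjoint is the quotient. -/
theorem exists_contraction_comp_eq {S : FinTree} (T : ℕ → FinTree) (o : ∀ n, DFSOrder (T n))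
    (f : ∀ n, Contraction (T n) S) :
    ∃ i j, i < j ∧ ∃ φ : Contraction (T j) (T i), φ.comp (f i) = f j ∧
      φ.toFun (o j).root = (o i).root ∧ ∀ (R : FinTree) (a b : Contraction (T i) R),
        (o i).key a < (o i).key b → (o j).key (φ.comp a) < (o j).key (φ.comp b) := by
  obtain ⟨i, j, hij, he⟩ := LabelledForest.wellQuasiOrdered_embeds
    fun n => (⟨(o n).toLabelledForest (f n), Set.univ⟩ : LabelledForest.Part (Set S.V × Prop))
  rcases he with he | ⟨h, hh⟩
  · have : (o i).root ∈ (Set.univ : Set (T i).V) := trivial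
    exact absurd (show (Set.univ : Set (T i).V) = ∅ from he) (Set.nonempty_iff_ne_empty.1 ⟨_, this⟩)
  have hlab : ∀ a : (T i).V, ({s | (o j).sec (f j) s = h a}, h a = (o j).root) =
      ({s | (o i).sec (f i) s = a}, a = (o i).root) := fun a => hh.lab a trivial
  have emb : IsEmbedding (o i) (o j) h :=
    ⟨(congrArg Prod.snd (hlab (o i).root)).mpr rfl,
      fun a b => hh.lt a trivial b trivial, fun a b => hh.anc a trivial b trivial⟩
  have hsec : ∀ s, (o j).sec (f j) s = h ((o i).sec (f i) s) := fun s =>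
    (Set.ext_iff.1 (congrArg Prod.fst (hlab ((o i).sec (f i) s))) s).2 rfl
  obtain ⟨φ, hφ⟩ := emb.exists_contraction
  refine ⟨i, j, hij, φ, ?_, ?_, fun R a b => emb.key_lt hφ⟩
  · exact (o j).eq_of_sec_eq fun s => by rw [emb.sec_comp hφ, hsec]
  · rw [← emb.root, ← hφ, (o j).map_sec]

end DFSOrder

end FinTree

/-! ### Representations of categories of trees -/

/-- The forgetful functor from rooted trees to trees. -/
def RootedFinTree.forget : RootedFinTree ⥤ FinTree where
  obj S := S.tree
  map f := f.toContraction

instance : RootedFinTree.forget.Faithful where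
  map_injective h := RootedFinTree.Contraction.ext h

/-- Let `D` be a category of trees with extra structure. If each object has an admissible depth-first
order, and all contractions that match the roots of admissible orders are morphisms of `D`, then
representations of the opposite of `D` are locally Noetherian. -/
theorem repLocallyNoetherian_op_of_faithful (k : Type u) [CommRing k] [IsNoetherianRing k]
    {D : Type w} [Category.{v} D] (F : D ⥤ FinTree) [F.Faithful]
    (O : ∀ X : D, Set (FinTree.DFSOrder (F.obj X))) (hO : ∀ X, (O X).Nonempty)
    (hlift : ∀ (X Y : D) (o : O X) (o' : O Y) (φ : FinTree.Contraction (F.obj X) (F.obj Y)),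
      φ.toFun o.1.root = o'.1.root → ∃ g : X ⟶ Y, F.map g = φ) :
    RepLocallyNoetherian k Dᵒᵖ := by
  have hfaith : ∀ {X Y : Dᵒᵖ} {f g : X ⟶ Y}, F.map f.unop = F.map g.unop → f = g :=
    fun h => Quiver.Hom.unop_inj (F.map_injective h)
  have (X Y : Dᵒᵖ) : Finite (X ⟶ Y) :=
    Finite.of_injective (fun f => F.map f.unop) fun _ _ h => hfaith h
  have (X : Dᵒᵖ) : Nonempty (O X.unop) := (hO X.unop).to_subtype
  refine repLocallyNoetherian_of_wellQuasiOrdered (O := fun X => O X.unop)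
    (key := fun {X Y} o (f : X ⟶ Y) => o.1.key (S := F.obj X.unop) (F.map f.unop))
    (fun o _ _ h => hfaith (o.1.key_injective h)) fun S X o f => ?_
  obtain ⟨i, j, hij, φ, h1, h2, h3⟩ := FinTree.DFSOrder.exists_contraction_comp_eq
    (fun n => F.obj (X n).unop) (fun n => (o n).1) (fun n => F.map (f n).unop)
  obtain ⟨g, rfl⟩ := hlift _ _ (o j) (o i) φ h2
  refine ⟨i, j, hij, g.op, hfaith ((F.map_comp _ _).trans h1), fun R a b hab => ?_⟩
  have := h3 _ _ _ hab
  dsimp only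
  rw [unop_comp, unop_comp, F.map_comp, F.map_comp]
  exact this

theorem FinTree.univ_dfsOrder_nonempty (T : FinTree) :
    (Set.univ : Set (FinTree.DFSOrder T)).Nonempty := by
  obtain ⟨r⟩ := T.isTree.connected.nonempty
  exact ⟨(T.exists_dfsOrder r).choose, trivial⟩

theorem theorem1p1 (k : Type u) [CommRing k] [IsNoetherianRing k] :
    RepLocallyNoetherian k FinTreeᵒᵖ ∧
    RepLocallyNoetherian k RootedFinTreeᵒᵖ ∧
    ∀ l : ℕ, 2 ≤ l → RepLocallyNoetherian k (FinTree.AtMostLeaves l)ᵒᵖ := by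
  refine ⟨?_, ?_, fun l _ => ?_⟩
  · exact repLocallyNoetherian_op_of_faithful k (𝟭 FinTree) (fun _ => Set.univ)
      (fun T => T.univ_dfsOrder_nonempty) fun _ _ _ _ φ _ => ⟨φ, rfl⟩
  · exact repLocallyNoetherian_op_of_faithful k RootedFinTree.forget
      (fun T => {o | o.root = T.root}) (fun T => T.tree.exists_dfsOrder T.root)
      fun _ _ o o' φ h => ⟨⟨φ, by rw [← o.2, h, o'.2]⟩, rfl⟩
  -- A full subcategory: nothing about leaves enters.
  · exact repLocallyNoetherian_op_of_faithful k (ObjectProperty.ι _) (fun _ => Set.univ)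
      (fun T => T.obj.univ_dfsOrder_nonempty) fun _ _ _ _ φ _ => ⟨⟨φ⟩, rfl⟩
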